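/- **Theorem.** Let $K$ be an algebraically closed field and let $\Lambda$ be a connected finite dimensional gentle $K$-algebra. Suppose that, for some integer $d \geq 2$, the category $\operatorname{mod} \Lambda$ of finitely generated right $\Lambda$-modules contains a $d$-cluster tilting subcategory. Then $\Lambda$ is a radical square zero Nakayama algebra; that is, as a $K$-algebra, $\Lambda$ is isomorphic to $KA_n/J^2$ for some $n \geq 1$ or to $K\widetilde{A}_n/J^2$ for some $n \geq 0$. Here $A_n$ is the linearly oriented quiver $1 \to 2 \to \cdots \to n$, $\widetilde{A}_n$ is the cyclically oriented quiver $0 \to 1 \to \cdots \to n \to 0$ (a single loop if $n = 0$), and $J$ is the arrow ideal, i.e. the two-sided ideal generated by the arrows. Definitions. The product $\alpha\beta$ of arrows in a path algebra $KQ$ is the path "first $\alpha$, then $\beta$", defined when $\alpha$ ends where $\beta$ starts. A $K$-algebra is *gentle* if it is isomorphic to $KQ/I$, where $Q$ is a finite quiver and $I$ is a two-sided ideal of $KQ$ such that: for every arrow $\alpha$ there is at most one arrow $\beta$ starting where $\alpha$ ends with $\alpha\beta \notin I$ and at most one with $\alpha\beta \in I$; for every arrow $\alpha$ there is at most one arrow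 $\gamma$ ending where $\alpha$ starts with $\gamma\alpha \notin I$ and at most one with $\gamma\alpha \in I$; the ideal $I$ is admissible ($J^m \subseteq I \subseteq J^2$ for some $m$); and $I$ is generated by the paths of length two that it contains. An algebra is *connected* if it is nonzero and its only central idempotents are $0$ and $1$. A full subcategory $\mathcal{U}$ of an abelian category $\mathcal{C}$ is *$d$-cluster tilting* if it is functorially finite (every object of $\mathcal{C}$ has a right and a left $\mathcal{U}$-approximation), generating and cogenerating (every object of $\mathcal{C}$ is a quotient of an object of $\mathcal{U}$ and embeds into an object of $\mathcal{U}$), and $$\mathcal{U} = \{X \in \mathcal{C} \mid \operatorname{Ext}^i_{\mathcal{C}}(\mathcal{U}, X) = 0 \text{ for } 1 \leq i \leq d-1\} = \{X \in \mathcal{C} \mid \operatorname{Ext}^i_{\mathcal{C}}(X, \mathcal{U}) = 0 \text{ for } 1 \leq i \leq d-1\}.$$ -/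

import Mathlib

open CategoryTheory

universe u v w uQ vQ

noncomputable section

/-! ## Path algebras of finite quivers -/

/-- The type of all paths (including the trivial ones) of a quiver `Q`. -/
abbrev QuiverPath (Q : Type*) [Quiver Q] := Σ x y : Q, Quiver.Path x y

/-- The path algebra `K Q`: the `K`-vector space with basis the paths of `Q`. -/
def PathAlgebra (K Q : Type*) [Field K] [Quiver Q] := QuiverPath Q →₀ K

namespace PathAlgebra

section

variable {K Q : Type*} [Field K] [Quiver Q]

instance : AddCommGroup (PathAlgebra K Q) := inferInstanceAs (AddCommGroup (QuiverPath Q →₀ K))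

instance : Module K (PathAlgebra K Q) := inferInstanceAs (Module K (QuiverPath Q →₀ K))

variable (K) in
/-- The basis element of `K Q` given by a path. -/
def ofPath {x y : Q} (p : Quiver.Path x y) : PathAlgebra K Q :=
  (Finsupp.single (⟨x, y, p⟩ : QuiverPath Q) (1 : K) : QuiverPath Q →₀ K)

open Classical in
variable (K) in
/-- The product of two basis elements: concatenation `p q` (first `p`, then `q`) if `p` ends
where `q` starts, and zero otherwise. -/
def mulPath (p q : QuiverPath Q) : PathAlgebra K Q :=
  if h : p.2.1 = q.1 then ofPath K (p.2.2.comp (q.2.2.cast h.symm rfl)) else 0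

variable (K Q) in
/-- The bilinear extension of `mulPath`. -/
def mulLin : PathAlgebra K Q →ₗ[K] PathAlgebra K Q →ₗ[K] PathAlgebra K Q :=
  Finsupp.linearCombination K fun p : QuiverPath Q =>
    (Finsupp.linearCombination K fun q : QuiverPath Q => mulPath K p q :
      (QuiverPath Q →₀ K) →ₗ[K] PathAlgebra K Q)

instance : Mul (PathAlgebra K Q) := ⟨fun a b => mulLin K Q a b⟩

theorem mul_def (a b : PathAlgebra K Q) : a * b = mulLin K Q a b := rfl

theorem mulLin_ofPath {x y z w : Q} (p : Quiver.Path x y) (q : Quiver.Path z w) :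
    mulLin K Q (ofPath K p) (ofPath K q) = mulPath K ⟨x, y, p⟩ ⟨z, w, q⟩ := by
  unfold mulLin ofPath
  erw [Finsupp.linearCombination_single, one_smul, Finsupp.linearCombination_single, one_smul]

theorem ofPath_mul_ofPath {x y z : Q} (p : Quiver.Path x y) (q : Quiver.Path y z) :
    ofPath K p * ofPath K q = ofPath K (p.comp q) := by
  rw [mul_def, mulLin_ofPath]; simp [mulPath]

theorem ofPath_mul_ofPath_of_ne {x y z w : Q} (p : Quiver.Path x y) (q : Quiver.Path z w)
    (h : y ≠ z) : ofPath K p * ofPath K q = 0 := by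
  rw [mul_def, mulLin_ofPath]; simp [mulPath, h]

@[elab_as_elim]
theorem induction {P : PathAlgebra K Q → Prop} (a : PathAlgebra K Q) (h0 : P 0)
    (hadd : ∀ a b, P a → P b → P (a + b))
    (hsmul : ∀ (c : K) {x y : Q} (p : Quiver.Path x y), P (c • ofPath K p)) : P a := by
  refine Finsupp.induction_linear (motive := P) a h0 hadd ?_
  rintro ⟨x, y, p⟩ c
  have := hsmul c p
  unfold ofPath at this
  erw [Finsupp.smul_single, smul_eq_mul, mul_one] at this
  exact this

theorem smul_mul' (c : K) (a b : PathAlgebra K Q) : (c • a) * b = c • (a * b) := by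
  simp [mul_def]

theorem mul_smul' (c : K) (a b : PathAlgebra K Q) : a * (c • b) = c • (a * b) := by
  simp [mul_def]

theorem add_mul' (a b c : PathAlgebra K Q) : (a + b) * c = a * c + b * c := by
  simp [mul_def]

theorem mul_add' (a b c : PathAlgebra K Q) : a * (b + c) = a * b + a * c := by
  simp [mul_def]

theorem zero_mul' (a : PathAlgebra K Q) : 0 * a = 0 := by
  simp [mul_def]

theorem mul_zero' (a : PathAlgebra K Q) : a * 0 = 0 := by
  simp [mul_def]

theorem mul_assoc' (a b c : PathAlgebra K Q) : a * b * c = a * (b * c) := by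
  induction a using induction with
  | h0 => simp [zero_mul']
  | hadd a a' h h' => simp [add_mul', h, h']
  | hsmul r p =>
    induction b using induction with
    | h0 => simp [zero_mul', mul_zero']
    | hadd b b' h h' => simp [add_mul', mul_add', h, h']
    | hsmul s q =>
      induction c using induction with
      | h0 => simp [mul_zero']
      | hadd c c' h h' => simp [mul_add', h, h']
      | hsmul t u =>
        rename_i x y z w v v'
        simp only [smul_mul', mul_smul']
        congr 3
        by_cases h1 : y = z
        · subst h1
          by_cases h2 : w = v
          · subst h2
            simp [ofPath_mul_ofPath]
          · simp [ofPath_mul_ofPath, ofPath_mul_ofPath_of_ne, h2, mul_zero']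
        · by_cases h2 : w = v
          · subst h2
            simp [ofPath_mul_ofPath, ofPath_mul_ofPath_of_ne, h1, zero_mul']
          · simp [ofPath_mul_ofPath_of_ne, h1, h2, zero_mul', mul_zero']

variable [Fintype Q]

/-- The unit is the sum of the trivial paths. -/
instance instOnePathAlgebra : One (PathAlgebra K Q) := ⟨∑ x : Q, ofPath K (Quiver.Path.nil : Quiver.Path x x)⟩

theorem one_def :
    (1 : PathAlgebra K Q) = ∑ x : Q, ofPath K (Quiver.Path.nil : Quiver.Path x x) := rfl

theorem one_mul' (a : PathAlgebra K Q) : 1 * a = a := by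
  induction a using induction with
  | h0 => exact mul_zero' _
  | hadd a b h h' => rw [mul_add', h, h']
  | hsmul c p =>
    rename_i x y
    rw [mul_smul', one_def, mul_def, map_sum, LinearMap.sum_apply, Finset.sum_eq_single x]
    · rw [← mul_def, ofPath_mul_ofPath, Quiver.Path.nil_comp]
    · intro z _ hz
      rw [← mul_def, ofPath_mul_ofPath_of_ne _ _ hz]
    · simp

theorem mul_one' (a : PathAlgebra K Q) : a * 1 = a := by
  induction a using induction with
  | h0 => exact zero_mul' _
  | hadd a b h h' => rw [add_mul', h, h']
  | hsmul c p =>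
    rename_i x y
    rw [smul_mul', one_def, mul_def, map_sum, Finset.sum_eq_single y]
    · rw [← mul_def, ofPath_mul_ofPath, Quiver.Path.comp_nil]
    · intro z _ hz
      rw [← mul_def, ofPath_mul_ofPath_of_ne _ _ hz.symm]
    · simp

instance : Ring (PathAlgebra K Q) :=
  { (inferInstance : AddCommGroup (PathAlgebra K Q)) with
    mul := (· * ·)
    one := 1
    left_distrib := mul_add'
    right_distrib := add_mul'
    zero_mul := zero_mul'
    mul_zero := mul_zero'
    mul_assoc := mul_assoc'
    one_mul := one_mul'
    mul_one := mul_one' }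

instance : Algebra K (PathAlgebra K Q) := Algebra.ofModule smul_mul' mul_smul'

end

variable (K Q : Type*) [Field K] [Quiver Q] [Fintype Q]

/-- The power `J ^ m` of the arrow ideal `J` of `K Q`, that is, the two-sided ideal generated by
the paths of length `m`. -/
def arrowIdealPow (m : ℕ) : TwoSidedIdeal (PathAlgebra K Q) :=
  TwoSidedIdeal.span {a | ∃ (x y : Q) (p : Quiver.Path x y), p.length = m ∧ a = ofPath K p}

end PathAlgebra

/-! ## Gentle algebras -/

section Gentle

variable {K Q : Type*} [Field K] [Quiver Q] [Fintype Q]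

/-- The product `α β` in `K Q` of two composable arrows. -/
def arrowMul (K : Type*) [Field K] {x y z : Q} (α : x ⟶ y) (β : y ⟶ z) : PathAlgebra K Q :=
  PathAlgebra.ofPath K (α.toPath.comp β.toPath)

/-- An ideal `I` of `K Q` is admissible if `J ^ m ⊆ I ⊆ J ^ 2` for some `m`. -/
def IsAdmissible (I : TwoSidedIdeal (PathAlgebra K Q)) : Prop :=
  I ≤ PathAlgebra.arrowIdealPow K Q 2 ∧ ∃ m : ℕ, PathAlgebra.arrowIdealPow K Q m ≤ I

/-- The conditions on `(Q, I)` under which `K Q / I` is gentle (the finiteness of the set of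
vertices is the ambient `Fintype Q`). `Quiver.Star y` is the type of arrows starting in `y` and
`Quiver.Costar x` is the type of arrows ending in `x`. -/
structure IsGentlePresentation (I : TwoSidedIdeal (PathAlgebra K Q)) : Prop where
  finite_arrows : ∀ x y : Q, Finite (x ⟶ y)
  right_nonzero : ∀ {x y : Q} (α : x ⟶ y),
    {β : Quiver.Star y | arrowMul K α β.2 ∉ I}.Subsingleton
  left_nonzero : ∀ {x y : Q} (α : x ⟶ y),
    {γ : Quiver.Costar x | arrowMul K γ.2 α ∉ I}.Subsingleton
  right_zero : ∀ {x y : Q} (α : x ⟶ y),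
    {β : Quiver.Star y | arrowMul K α β.2 ∈ I}.Subsingleton
  left_zero : ∀ {x y : Q} (α : x ⟶ y),
    {γ : Quiver.Costar x | arrowMul K γ.2 α ∈ I}.Subsingleton
  admissible : IsAdmissible I
  generated : I = TwoSidedIdeal.span
    {a | a ∈ I ∧ ∃ (x y z : Q) (α : x ⟶ y) (β : y ⟶ z), a = arrowMul K α β}

end Gentle

/-- A `K`-algebra is gentle if it is of the form `K Q / I` with `(Q, I)` as above. -/
def IsGentleAlgebra (K : Type u) (Λ : Type w) [Field K] [Ring Λ] [Algebra K Λ] : Prop :=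
  ∃ (Q : Type uQ) (_ : Quiver.{vQ} Q) (_ : Fintype Q) (I : TwoSidedIdeal (PathAlgebra K Q)),
    IsGentlePresentation I ∧ Nonempty (Λ ≃ₐ[K] I.ringCon.Quotient)

/-- A ring is connected if it is nonzero and is not a product of two nonzero rings, that is, it has
no central idempotents other than `0` and `1 ≠ 0`. -/
def IsConnectedRing (Λ : Type*) [Ring Λ] : Prop :=
  Nontrivial Λ ∧ ∀ e ∈ Subring.center Λ, e * e = e → e = 0 ∨ e = 1

/-! ## Radical square zero Nakayama algebras -/

/-- The set of vertices of the linear quiver with `n` vertices. -/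
def LinearQuiver (n : ℕ) : Type := Fin n

instance (n : ℕ) : Fintype (LinearQuiver n) := inferInstanceAs (Fintype (Fin n))

/-- The linearly oriented quiver `A_n`: one arrow from each vertex to its successor. -/
instance (n : ℕ) : Quiver.{0} (LinearQuiver n) :=
  ⟨fun i j => PLift ((show Fin n from i).val + 1 = (show Fin n from j).val)⟩

/-- The set of vertices of the cyclic quiver with vertices `0, …, n`. -/
def CyclicQuiver (n : ℕ) : Type := Fin (n + 1)

instance (n : ℕ) : Fintype (CyclicQuiver n) := inferInstanceAs (Fintype (Fin (n + 1)))

/-- The cyclically oriented quiver with vertices `0, …, n`: one arrow from each vertex to its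
successor modulo `n + 1` (a loop if `n = 0`). -/
instance (n : ℕ) : Quiver.{0} (CyclicQuiver n) :=
  ⟨fun i j => PLift (((show Fin (n + 1) from i).val + 1) % (n + 1) =
    (show Fin (n + 1) from j).val)⟩

/-- `K Q / J ^ 2`, where `J` is the arrow ideal. -/
abbrev RadSqZeroPathAlgebra (K Q : Type*) [Field K] [Quiver Q] [Fintype Q] :=
  (PathAlgebra.arrowIdealPow K Q 2).ringCon.Quotient

/-- A `K`-algebra is a radical square zero Nakayama algebra if it is the path algebra of a linearly
oriented or of a cyclically oriented quiver modulo the square of the arrow ideal. -/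
def IsRadSqZeroNakayama (K : Type*) (Λ : Type*) [Field K] [Ring Λ] [Algebra K Λ] : Prop :=
  (∃ n : ℕ, 1 ≤ n ∧ Nonempty (Λ ≃ₐ[K] RadSqZeroPathAlgebra K (LinearQuiver n))) ∨
    ∃ n : ℕ, Nonempty (Λ ≃ₐ[K] RadSqZeroPathAlgebra K (CyclicQuiver n))

/-! ## `d`-cluster tilting subcategories -/

section ClusterTilting

variable {C : Type u} [Category.{v} C]

/-- Every object has a right approximation by an object of the full subcategory `U`. -/
def IsContravariantlyFinite (U : ObjectProperty C) : Prop :=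
  ∀ X : C, ∃ (Y : C) (_ : U Y) (f : Y ⟶ X), ∀ (Y' : C), U Y' → ∀ g : Y' ⟶ X, ∃ h, h ≫ f = g

/-- Every object has a left approximation by an object of the full subcategory `U`. -/
def IsCovariantlyFinite (U : ObjectProperty C) : Prop :=
  ∀ X : C, ∃ (Y : C) (_ : U Y) (f : X ⟶ Y), ∀ (Y' : C), U Y' → ∀ g : X ⟶ Y', ∃ h, f ≫ h = g

variable [Abelian C] [HasExt.{w} C]

/-- The objects `X` with `Ext ^ i (U, X) = 0` for `1 ≤ i ≤ d - 1`. -/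
def extRightPerp (U : ObjectProperty C) (d : ℕ) : ObjectProperty C := fun X =>
  ∀ Y : C, U Y → ∀ i : ℕ, 1 ≤ i → i < d → Subsingleton (Abelian.Ext.{w} Y X i)

/-- The objects `X` with `Ext ^ i (X, U) = 0` for `1 ≤ i ≤ d - 1`. -/
def extLeftPerp (U : ObjectProperty C) (d : ℕ) : ObjectProperty C := fun X =>
  ∀ Y : C, U Y → ∀ i : ℕ, 1 ≤ i → i < d → Subsingleton (Abelian.Ext.{w} X Y i)

/-- `d`-cluster tilting (full) subcategories of an abelian category. -/
structure IsDClusterTilting (d : ℕ) (U : ObjectProperty C) : Prop where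
  contravariantlyFinite : IsContravariantlyFinite U
  covariantlyFinite : IsCovariantlyFinite U
  generating : ∀ X : C, ∃ (Y : C) (_ : U Y) (f : Y ⟶ X), Epi f
  cogenerating : ∀ X : C, ∃ (Y : C) (_ : U Y) (f : X ⟶ Y), Mono f
  eq_rightPerp : U = extRightPerp.{u, v, w} U d
  eq_leftPerp : U = extLeftPerp.{u, v, w} U d

end ClusterTilting

theorem isNoetherianRing_mulOpposite (K : Type u) (Λ : Type w) [Field K] [Ring Λ] [Algebra K Λ]
    [Module.Finite K Λ] : IsNoetherianRing Λᵐᵒᵖ :=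
  have : Module.Finite K Λᵐᵒᵖ := Module.Finite.equiv (MulOpposite.opLinearEquiv K (M := Λ))
  isNoetherian_of_tower K inferInstance

/-- The category of finitely generated right modules over the finite dimensional `K`-algebra `Λ`
(right `Λ`-modules are `Λᵐᵒᵖ`-modules) contains a `d`-cluster tilting subcategory. -/
def HasDClusterTiltingSubcategory (K : Type u) (Λ : Type w) [Field K] [Ring Λ] [Algebra K Λ]
    [Module.Finite K Λ] (d : ℕ) : Prop :=
  haveI : IsNoetherianRing Λᵐᵒᵖ := isNoetherianRing_mulOpposite K Λ
  haveI : HasExt.{w + 1} (FGModuleCat.{w} Λᵐᵒᵖ) := HasExt.standard _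
  ∃ U : ObjectProperty (FGModuleCat.{w} Λᵐᵒᵖ), IsDClusterTilting.{w + 1, w, w + 1} d U

end

/-!
A `d`-cluster tilting subcategory contains all projectives and all injectives, so every extension of
the injective module `D Λ` by the projective module `Λ` splits. For `Λ = K Q / I` such extensions
come from outer double derivations: if `G β = F α` whenever `α β ∈ I`, then sending `α : x ⟶ y` to
the map `m ↦ G α • m e_x • α - F α • m α • e_y` from `D Λ` to `Λ` respects the monomial relations,
and a splitting forces `G α = c x` and `F α = c y` for a single weight `c` on the vertices. For
indicator weights this leaves at most one arrow starting, and at most one ending, at each vertex,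
and puts every path of length two in `I`. So `I = J ^ 2`, and connectedness leaves only a line or
an oriented cycle.
-/

noncomputable section

section Splitting

/-- Every extension of an injective object by a projective object splits. This is the vanishing of
`Ext¹ (I, P)` for `I` injective and `P` projective, stated without a choice of `Ext` groups. -/
def InjProjExtensionsSplit (C : Type u) [Category.{v} C] [Abelian C] : Prop :=
  ∀ S : ShortComplex C, S.ShortExact → Projective S.X₁ → Injective S.X₃ → IsSplitEpi S.g

section Abelian

variable {C : Type u} [Category.{v} C] [Abelian C] [HasExt.{w} C]

theorem IsDClusterTilting.subsingleton_ext_one {d : ℕ} {U : ObjectProperty C}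
    (hU : IsDClusterTilting.{u, v, w} d U) (hd : 2 ≤ d) (I P : C) [Injective I] [Projective P] :
    Subsingleton (Abelian.Ext.{w} I P 1) := by
  have hI : U I := by
    rw [hU.eq_rightPerp]
    intro Y _ i hi _
    obtain ⟨n, rfl⟩ := Nat.exists_eq_add_of_le' hi
    exact subsingleton_of_forall_eq 0 Abelian.Ext.eq_zero_of_injective
  have hP : U P := by
    rw [hU.eq_leftPerp]
    intro Y _ i hi _
    obtain ⟨n, rfl⟩ := Nat.exists_eq_add_of_le' hi
    exact subsingleton_of_forall_eq 0 Abelian.Ext.eq_zero_of_projective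
  rw [hU.eq_rightPerp] at hP
  exact hP I hI 1 le_rfl hd

theorem isSplitEpi_of_subsingleton_ext_one {S : ShortComplex C} (hS : S.ShortExact)
    [Subsingleton (Abelian.Ext.{w} S.X₃ S.X₁ 1)] : IsSplitEpi S.g := by
  obtain ⟨x, hx⟩ := Abelian.Ext.covariant_sequence_exact₃ S.X₃ hS
    (Abelian.Ext.mk₀ (𝟙 S.X₃)) (zero_add 1) (Subsingleton.elim _ _)
  obtain ⟨s, rfl⟩ := (Abelian.Ext.mk₀_bijective _ _).2 x
  rw [Abelian.Ext.mk₀_comp_mk₀] at hx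
  exact ⟨⟨s, (Abelian.Ext.mk₀_bijective _ _).1 hx⟩⟩

theorem IsDClusterTilting.injProjExtensionsSplit {d : ℕ} {U : ObjectProperty C}
    (hU : IsDClusterTilting.{u, v, w} d U) (hd : 2 ≤ d) : InjProjExtensionsSplit C :=
  fun S hS _ _ =>
    have := hU.subsingleton_ext_one hd S.X₃ S.X₁
    isSplitEpi_of_subsingleton_ext_one hS

end Abelian

theorem HasDClusterTiltingSubcategory.injProjExtensionsSplit {K : Type u} {Λ : Type w} [Field K]
    [Ring Λ] [Algebra K Λ] [Module.Finite K Λ] [IsNoetherianRing Λᵐᵒᵖ] {d : ℕ}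
    (h : HasDClusterTiltingSubcategory K Λ d) (hd : 2 ≤ d) :
    InjProjExtensionsSplit (FGModuleCat.{w} Λᵐᵒᵖ) := by
  have : HasExt.{w + 1} (FGModuleCat.{w} Λᵐᵒᵖ) := HasExt.standard _
  obtain ⟨U, hU⟩ := h
  exact hU.injProjExtensionsSplit hd

section FGModuleCat

variable {R : Type w} [Ring R] [IsNoetherianRing R]

theorem fgModuleCat_mono_iff_injective {X Y : FGModuleCat.{w} R} (f : X ⟶ Y) :
    Mono f ↔ Function.Injective f.hom.hom :=
  ((forget₂ (FGModuleCat.{w} R) (ModuleCat.{w} R)).mono_map_iff_mono f).symm.trans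
    (ModuleCat.mono_iff_injective _)

theorem fgModuleCat_epi_iff_surjective {X Y : FGModuleCat.{w} R} (f : X ⟶ Y) :
    Epi f ↔ Function.Surjective f.hom.hom :=
  ((forget₂ (FGModuleCat.{w} R) (ModuleCat.{w} R)).epi_map_iff_epi f).symm.trans
    (ModuleCat.epi_iff_surjective _)

theorem fgModuleCat_projective_of_projective (P : Type w) [AddCommGroup P] [Module R P]
    [Module.Finite R P] [Module.Projective R P] : Projective (FGModuleCat.of R P) where
  factors {E _} f g _ := by
    obtain ⟨k, hk⟩ := Module.projective_lifting_property g.hom.hom f.hom.hom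
      ((fgModuleCat_epi_iff_surjective g).1 inferInstance)
    exact ⟨(FGModuleCat.ofHom k : _ ⟶ FGModuleCat.of R E), by ext1; exact hk⟩

theorem fgModuleCat_injective_of_baer (I : Type w) [AddCommGroup I] [Module R I]
    [Module.Finite R I] (hI : Module.Baer R I) : Injective (FGModuleCat.of R I) where
  factors {_ Y} f g _ := by
    obtain ⟨k, hk⟩ := hI.extension_property g.hom.hom
      ((fgModuleCat_mono_iff_injective g).1 inferInstance) f.hom.hom
    exact ⟨(FGModuleCat.ofHom k : FGModuleCat.of R Y ⟶ _), by ext1; exact hk⟩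

theorem fgModuleCat_shortExact (S : ShortComplex (FGModuleCat.{w} R))
    (hf : Function.Injective S.f.hom.hom) (hg : Function.Surjective S.g.hom.hom)
    (hfg : Function.Exact S.f.hom.hom S.g.hom.hom) : S.ShortExact where
  exact := (S.exact_map_iff_of_faithful (forget₂ (FGModuleCat.{w} R) (ModuleCat.{w} R))).1
    ((ShortComplex.ShortExact.moduleCat_exact_iff_function_exact _).2 hfg)
  mono_f := (fgModuleCat_mono_iff_injective _).2 hf
  epi_g := (fgModuleCat_epi_iff_surjective _).2 hg

namespace InjProjExtensionsSplit

theorem exists_section_of_exact (h : InjProjExtensionsSplit (FGModuleCat.{w} R))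
    {A E B : Type w} [AddCommGroup A] [AddCommGroup E] [AddCommGroup B] [Module R A] [Module R E]
    [Module R B] [Module.Finite R A] [Module.Finite R E] [Module.Finite R B]
    [Module.Projective R A] (hB : Module.Baer R B) {f : A →ₗ[R] E} {g : E →ₗ[R] B}
    (hf : Function.Injective f) (hg : Function.Surjective g) (hfg : Function.Exact f g) :
    ∃ s : B →ₗ[R] E, g ∘ₗ s = LinearMap.id := by
  let S : ShortComplex (FGModuleCat.{w} R) := ShortComplex.mk (FGModuleCat.ofHom f)
    (FGModuleCat.ofHom g) (FGModuleCat.hom_ext hfg.linearMap_comp_eq_zero)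
  obtain ⟨⟨s, hs⟩⟩ := h S (fgModuleCat_shortExact S hf hg hfg)
    (fgModuleCat_projective_of_projective A) (fgModuleCat_injective_of_baer B hB)
  exact ⟨s.hom.hom, congrArg (fun t => t.hom.hom) hs⟩

theorem exists_section (h : InjProjExtensionsSplit (FGModuleCat.{w} R))
    {A E B : Type*} [AddCommGroup A] [AddCommGroup E] [AddCommGroup B] [Module R A] [Module R E]
    [Module R B] [Module.Finite R A] [Module.Finite R E] [Module.Finite R B]
    [Module.Projective R A] (hB : Module.Baer R B) {f : A →ₗ[R] E} {g : E →ₗ[R] B}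
    (hf : Function.Injective f) (hg : Function.Surjective g) (hfg : Function.Exact f g) :
    ∃ s : B →ₗ[R] E, g ∘ₗ s = LinearMap.id := by
  have := Module.Finite.small.{w} R A
  have := Module.Finite.small.{w} R E
  have := Module.Finite.small.{w} R B
  let a := Shrink.linearEquiv.{w} R A
  let e := Shrink.linearEquiv.{w} R E
  let b := Shrink.linearEquiv.{w} R B
  have := Module.Projective.of_equiv a.symm
  have hfg' : Function.Exact (e.symm ∘ₗ f ∘ₗ a) (b.symm ∘ₗ g ∘ₗ e) :=
    .of_ladder_linearEquiv_of_exact (e₁ := a.symm) (e₂ := e.symm) (e₃ := b.symm)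
      (by ext; simp) (by ext; simp) hfg
  obtain ⟨s, hs⟩ := h.exists_section_of_exact (hB.of_equiv b.symm)
    (e.symm.injective.comp (hf.comp a.injective)) (b.symm.surjective.comp (hg.comp e.surjective))
    hfg'
  refine ⟨e ∘ₗ s ∘ₗ b.symm, LinearMap.ext fun x => b.symm.injective ?_⟩
  exact LinearMap.congr_fun hs (b.symm x)

end InjProjExtensionsSplit

end FGModuleCat

end Splitting

theorem InjProjExtensionsSplit.exists_equivariant_section {R : Type w} [Ring R] [IsNoetherianRing R]
    (h : InjProjExtensionsSplit (FGModuleCat.{w} R)) {S A V B : Type*} [Semiring S]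
    [AddCommGroup A] [AddCommGroup V] [AddCommGroup B] [Module R A] [Module S V] [Module R B]
    [Module.Finite R A] [Module.Finite R B] [Module.Projective R A] (hB : Module.Baer R B)
    (θ : R →+* Module.End S V) {f : A →+ V} {g : V →+ B} (hf : Function.Injective f)
    (hg : Function.Surjective g) (hfg : Function.Exact f g)
    (hfθ : ∀ r a, f (r • a) = θ r (f a)) (hgθ : ∀ r x, g (θ r x) = r • g x) :
    ∃ s : B →+ V, (∀ b, g (s b) = b) ∧ ∀ r b, s (r • b) = θ r (s b) := by
  let _ : Module R V := Module.compHom V θ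
  let f' : A →ₗ[R] V := { f with map_smul' := hfθ }
  let g' : V →ₗ[R] B := { g with map_smul' := hgθ }
  have hfg' : Function.Exact f' g' := hfg
  have : IsNoetherian R V := isNoetherian_of_range_eq_ker f' g' hfg'.linearMap_ker_eq.symm
  obtain ⟨s, hs⟩ := h.exists_section hB hf hg hfg'
  exact ⟨s.toAddMonoidHom, LinearMap.congr_fun hs, map_smul s⟩

section Dual

variable (K : Type*) (Λ : Type*) [Field K] [Ring Λ] [Algebra K Λ]

/-- The right `Λ`-module structure on the `K`-dual of `Λ`, given by `(f · a) x = f (a x)`. -/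
abbrev dualRightModule : Module Λᵐᵒᵖ (Module.Dual K Λ) :=
  inferInstanceAs (Module Λᵈᵐᵃ (Module.Dual K Λ))

attribute [local instance] dualRightModule

variable {K Λ}

theorem dual_op_smul_apply (a : Λ) (f : Module.Dual K Λ) (x : Λ) :
    (MulOpposite.op a • f) x = f (a * x) := rfl

theorem dual_isScalarTower : IsScalarTower K Λᵐᵒᵖ (Module.Dual K Λ) :=
  ⟨fun c a f => by induction a; ext x; simp [← MulOpposite.op_smul, dual_op_smul_apply]⟩

theorem dual_finite [Module.Finite K Λ] : Module.Finite Λᵐᵒᵖ (Module.Dual K Λ) :=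
  have := dual_isScalarTower (K := K) (Λ := Λ)
  Module.Finite.of_restrictScalars_finite K Λᵐᵒᵖ _

theorem dual_baer : Module.Baer Λᵐᵒᵖ (Module.Dual K Λ) := by
  intro I g
  have := dual_isScalarTower (K := K) (Λ := Λ)
  obtain ⟨ψ, hψ⟩ := (LinearMap.applyₗ (1 : Λ) ∘ₗ g.restrictScalars K).exists_extend
    (p := I.restrictScalars K)
  refine ⟨LinearMap.toSpanSingleton _ _ (ψ ∘ₗ (MulOpposite.opLinearEquiv K).toLinearMap), ?_⟩
  intro r hr
  ext x
  have h : ψ (MulOpposite.op x * r) = g (MulOpposite.op x • ⟨r, hr⟩) 1 :=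
    LinearMap.congr_fun hψ (MulOpposite.op x • ⟨r, hr⟩ : I)
  rw [map_smul, dual_op_smul_apply, mul_one] at h
  exact h

end Dual

namespace PathAlgebra

section Generators

variable {K Q : Type*} [Field K] [Quiver Q]

variable (K) in
/-- The idempotent of `K Q` given by the trivial path at a vertex. -/
def vertex (x : Q) : PathAlgebra K Q := ofPath K (Quiver.Path.nil : Quiver.Path x x)

variable (K) in
/-- An arrow, as an element of `K Q`. -/
def arrow {x y : Q} (α : x ⟶ y) : PathAlgebra K Q := ofPath K α.toPath

theorem ofPath_mul_arrow {x y z : Q} (p : Quiver.Path x y) (α : y ⟶ z) :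
    ofPath K p * arrow K α = ofPath K (p.cons α) :=
  ofPath_mul_ofPath p α.toPath

theorem arrow_mul_arrow {x y z : Q} (α : x ⟶ y) (β : y ⟶ z) :
    arrow K α * arrow K β = arrowMul K α β :=
  ofPath_mul_ofPath _ _

theorem vertex_mul_arrow {x y : Q} (α : x ⟶ y) : vertex K x * arrow K α = arrow K α :=
  ofPath_mul_ofPath _ _

theorem arrow_mul_vertex {x y : Q} (α : x ⟶ y) : arrow K α * vertex K y = arrow K α :=
  ofPath_mul_ofPath _ _

theorem arrow_congr [Quiver.IsThin Q] {x y x' y' : Q} (hx : x = x') (hy : y = y') (α : x ⟶ y)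
    (α' : x' ⟶ y') : arrow K α = arrow K α' := by
  subst hx hy
  rw [Subsingleton.elim α α']

variable [Fintype Q]

theorem completeOrthogonalIdempotents_vertex :
    CompleteOrthogonalIdempotents (vertex K : Q → PathAlgebra K Q) where
  idem _ := ofPath_mul_ofPath _ _
  ortho _ _ h := ofPath_mul_ofPath_of_ne _ _ h
  complete := rfl

@[elab_as_elim]
theorem generator_induction {P : PathAlgebra K Q → Prop} (a : PathAlgebra K Q) (zero : P 0)
    (add : ∀ a b, P a → P b → P (a + b)) (smul : ∀ (c : K) a, P a → P (c • a))
    (vertex : ∀ x, P (PathAlgebra.vertex K x))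
    (mul_arrow : ∀ (a) {x y : Q} (α : x ⟶ y), P a → P (a * arrow K α)) : P a := by
  have ofPath_mem {x y : Q} (p : Quiver.Path x y) : P (ofPath K p) := by
    induction p with
    | nil => exact vertex x
    | cons p α ih =>
      rw [← ofPath_mul_arrow]
      exact mul_arrow _ α ih
  exact induction a zero add fun c _ _ p => smul c _ (ofPath_mem p)

theorem algHom_ext {A : Type*} [Ring A] [Algebra K A] {f g : PathAlgebra K Q →ₐ[K] A}
    (hvertex : ∀ x, f (vertex K x) = g (vertex K x))
    (harrow : ∀ (x y : Q) (α : x ⟶ y), f (arrow K α) = g (arrow K α)) : f = g := by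
  ext a
  induction a using generator_induction with
  | zero => simp only [map_zero]
  | add a b ha hb => simp only [map_add, ha, hb]
  | smul c a ha => simp only [map_smul, ha]
  | vertex x => exact hvertex x
  | mul_arrow a α ha => simp only [map_mul, ha, harrow]

end Generators

section Lift

variable {K Q A : Type*} [Field K] [Quiver Q] [Ring A] (e : Q → A)
  (a : ∀ x y : Q, (x ⟶ y) → A)

/-- The product of the images of the arrows of a path, where `e` is the image of the trivial
paths. -/
def pathImage : ∀ {x y : Q}, Quiver.Path x y → A
  | x, _, .nil => e x
  | _, _, .cons p α => pathImage p * a _ _ α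

variable [Algebra K A]

variable (K) in
/-- The linear extension of `pathImage` to the path algebra. -/
def liftLinear : PathAlgebra K Q →ₗ[K] A :=
  Finsupp.linearCombination K fun p : QuiverPath Q => pathImage e a p.2.2

theorem liftLinear_ofPath {x y : Q} (p : Quiver.Path x y) :
    liftLinear K e a (ofPath K p) = pathImage e a p :=
  (Finsupp.linearCombination_single K _ _).trans (one_smul K _)

variable {e a} [Fintype Q] (he : CompleteOrthogonalIdempotents e)
  (ha : ∀ (x y : Q) (α : x ⟶ y), e x * a x y α * e y = a x y α)

include he

theorem vertex_mul_pathImage {x y : Q} (p : Quiver.Path x y) :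
    e x * pathImage e a p = pathImage e a p := by
  induction p with
  | nil => simpa only [pathImage] using (he.idem x).eq
  | cons p α ih => rw [pathImage, ← mul_assoc, ih]

include ha

theorem pathImage_mul_vertex {x y : Q} (p : Quiver.Path x y) :
    pathImage e a p * e y = pathImage e a p := by
  cases p with
  | nil => simpa only [pathImage] using (he.idem x).eq
  | cons p α =>
    rw [pathImage, mul_assoc, ← ha, mul_assoc, (he.idem y).eq]

theorem pathImage_comp {x y z : Q} (p : Quiver.Path x y) (q : Quiver.Path y z) :
    pathImage e a (p.comp q) = pathImage e a p * pathImage e a q := by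
  induction q with
  | nil => rw [Quiver.Path.comp_nil, pathImage, pathImage_mul_vertex he ha]
  | cons q α ih => rw [Quiver.Path.comp_cons, pathImage, ih, mul_assoc, pathImage]

theorem pathImage_mul_pathImage_of_ne {x y z w : Q} (p : Quiver.Path x y) (q : Quiver.Path z w)
    (h : y ≠ z) : pathImage e a p * pathImage e a q = 0 := by
  rw [← pathImage_mul_vertex he ha p, ← vertex_mul_pathImage (a := a) he q, mul_assoc,
    ← mul_assoc (e y), he.ortho h, zero_mul, mul_zero]

theorem liftLinear_mul (b c : PathAlgebra K Q) :
    liftLinear K e a (b * c) = liftLinear K e a b * liftLinear K e a c := by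
  induction b using induction with
  | h0 => simp only [zero_mul, map_zero]
  | hadd b b' hb hb' => simp only [add_mul, map_add, hb, hb']
  | @hsmul r x y p =>
    induction c using induction with
    | h0 => simp only [mul_zero, map_zero]
    | hadd c c' hc hc' => simp only [mul_add, map_add, hc, hc']
    | @hsmul s z w q =>
      simp only [Algebra.smul_mul_assoc, Algebra.mul_smul_comm, map_smul]
      congr 2
      obtain rfl | hyz := eq_or_ne y z
      · simp only [ofPath_mul_ofPath, liftLinear_ofPath, pathImage_comp he ha]
      · rw [ofPath_mul_ofPath_of_ne p q hyz, map_zero, liftLinear_ofPath, liftLinear_ofPath,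
          pathImage_mul_pathImage_of_ne he ha p q hyz]

variable (K) in
/-- The universal property of the path algebra: an algebra homomorphism out of `K Q` is given by
complete orthogonal idempotents `e x` and elements `a α` of `e x * A * e y` for `α : x ⟶ y`. -/
def lift : PathAlgebra K Q →ₐ[K] A :=
  AlgHom.ofLinearMap (liftLinear K e a)
    (by simp only [one_def, map_sum, liftLinear_ofPath, pathImage, he.complete])
    (liftLinear_mul he ha)

@[simp]
theorem lift_vertex (x : Q) : lift K he ha (vertex K x) = e x :=
  (liftLinear_ofPath e a _).trans (by rw [pathImage])

@[simp]
theorem lift_arrow {x y : Q} (α : x ⟶ y) : lift K he ha (arrow K α) = a x y α := by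
  refine (liftLinear_ofPath e a _).trans ?_
  rw [Quiver.Hom.toPath, pathImage, pathImage, ← ha, ← mul_assoc, ← mul_assoc, (he.idem x).eq]

end Lift

end PathAlgebra

open PathAlgebra

/-- An ideal of a path algebra which is generated by paths of length two. -/
def IsQuadraticMonomial {K Q : Type*} [Field K] [Quiver Q] [Fintype Q]
    (I : TwoSidedIdeal (PathAlgebra K Q)) : Prop :=
  I = TwoSidedIdeal.span
    {a | a ∈ I ∧ ∃ (x y z : Q) (α : x ⟶ y) (β : y ⟶ z), a = arrowMul K α β}

theorem exists_algHom_comp_eq_of_ker_le {K A B C : Type*} [Field K] [Ring A] [Ring B] [Ring C]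
    [Algebra K A] [Algebra K B] [Algebra K C] {φ : A →ₐ[K] B} (hφ : Function.Surjective φ)
    (f : A →ₐ[K] C) (hf : TwoSidedIdeal.ker φ ≤ TwoSidedIdeal.ker f) :
    ∃ g : B →ₐ[K] C, ∀ a, g (φ a) = f a := by
  let ψ : (RingCon.ker φ.toRingHom).Quotient ≃ₐ[K] B := AlgEquiv.ofBijective (RingCon.kerLiftₐ φ)
    ⟨RingCon.kerLiftₐ_injective φ, RingCon.lift_surjective_of_surjective _ hφ⟩
  refine ⟨((RingCon.ker φ.toRingHom).liftₐ f (TwoSidedIdeal.ringCon_le_iff.1 hf)).comp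
    ψ.symm, fun a => ?_⟩
  have ψ_symm : ψ.symm (φ a) = (a : (RingCon.ker φ.toRingHom).Quotient) :=
    ψ.symm_apply_eq.2 rfl
  exact congrArg ((RingCon.ker φ.toRingHom).liftₐ f _) ψ_symm

section ArrowIdeal

variable {K Q : Type*} [Field K] [Quiver Q] [Fintype Q]

namespace PathAlgebra

theorem arrowIdealPow_two :
    arrowIdealPow K Q 2 =
      TwoSidedIdeal.span {a | ∃ (x y z : Q) (α : x ⟶ y) (β : y ⟶ z), a = arrowMul K α β} := by
  rw [arrowIdealPow]
  congr 1
  ext a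
  constructor
  · rintro ⟨x, z, p, hp, rfl⟩
    match p, hp with
    | .cons (.cons .nil α) β, _ => exact ⟨_, _, _, α, β, rfl⟩
  · rintro ⟨x, y, z, α, β, rfl⟩
    exact ⟨x, z, _, rfl, rfl⟩

theorem arrowMul_mem_arrowIdealPow_two {x y z : Q} (α : x ⟶ y) (β : y ⟶ z) :
    arrowMul K α β ∈ arrowIdealPow K Q 2 :=
  TwoSidedIdeal.subset_span ⟨x, z, _, rfl, rfl⟩

theorem arrowIdealPow_two_le_iff {I : TwoSidedIdeal (PathAlgebra K Q)} :
    arrowIdealPow K Q 2 ≤ I ↔ ∀ (x y z : Q) (α : x ⟶ y) (β : y ⟶ z), arrowMul K α β ∈ I := by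
  rw [arrowIdealPow_two, TwoSidedIdeal.span_le]
  constructor
  · exact fun h x y z α β => h ⟨x, y, z, α, β, rfl⟩
  · rintro h _ ⟨x, y, z, α, β, rfl⟩
    exact h x y z α β

end PathAlgebra

theorem IsQuadraticMonomial.le_iff {I I' : TwoSidedIdeal (PathAlgebra K Q)}
    (hI : IsQuadraticMonomial I) :
    I ≤ I' ↔ ∀ (x y z : Q) (α : x ⟶ y) (β : y ⟶ z), arrowMul K α β ∈ I → arrowMul K α β ∈ I' := by
  constructor
  · exact fun h x y z α β hαβ => h hαβ
  · intro h
    rw [hI, TwoSidedIdeal.span_le]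
    rintro _ ⟨hmem, x, y, z, α, β, rfl⟩
    exact h x y z α β hmem

theorem IsQuadraticMonomial.le_arrowIdealPow_two {I : TwoSidedIdeal (PathAlgebra K Q)}
    (hI : IsQuadraticMonomial I) : I ≤ arrowIdealPow K Q 2 :=
  hI.le_iff.2 fun _ _ _ α β _ => arrowMul_mem_arrowIdealPow_two α β

end ArrowIdeal

section Extension

attribute [local instance] dualRightModule dual_isScalarTower

section RightMul

variable (K : Type*) {Λ : Type*} [Field K] [Ring Λ] [Algebra K Λ]

/-- The action of `Λ` on the right module `Λ × Module.Dual K Λ`. -/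
def rightMul : Λ →ₐ[K] (Module.End K (Λ × Module.Dual K Λ))ᵐᵒᵖ :=
  AlgHom.opComm.symm (Algebra.lsmul K K (Λ × Module.Dual K Λ))

variable {K}

/-- The right multiplication by `a` on `Λ × Module.Dual K Λ`, deformed by `N`. -/
def twistedRightMul (a : Λ) (N : Module.Dual K Λ →ₗ[K] Λ) :
    (Module.End K (Λ × Module.Dual K Λ))ᵐᵒᵖ :=
  rightMul K a + MulOpposite.op (LinearMap.inl K Λ _ ∘ₗ N ∘ₗ LinearMap.snd K Λ _)

theorem rightMul_unop_apply (a : Λ) (v : Λ × Module.Dual K Λ) :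
    (rightMul K a).unop v = (v.1 * a, MulOpposite.op a • v.2) := rfl

theorem twistedRightMul_unop_apply (a : Λ) (N : Module.Dual K Λ →ₗ[K] Λ)
    (v : Λ × Module.Dual K Λ) :
    (twistedRightMul a N).unop v = (v.1 * a + N v.2, MulOpposite.op a • v.2) := by
  ext1
  · rfl
  · exact add_zero _

/-- The value at an arrow `a` from `e` to `e'` of the outer double derivation
`a ↦ G (e ⊗ a) - F (a ⊗ e')`, under the map `Λ ⊗ Λ → Hom (Module.Dual K Λ, Λ)`. -/
def arrowCocycle (G F : K) (e a e' : Λ) : Module.Dual K Λ →ₗ[K] Λ :=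
  G • (Module.Dual.eval K Λ e).smulRight a - F • (Module.Dual.eval K Λ a).smulRight e'

theorem arrowCocycle_apply (G F : K) (e a e' : Λ) (m : Module.Dual K Λ) :
    arrowCocycle G F e a e' m = G • m e • a - F • m a • e' := rfl

theorem rightMul_mul_twistedRightMul_mul_rightMul {e a e' : Λ} (he : IsIdempotentElem e)
    (he' : IsIdempotentElem e') (hea : e * a = a) (hae' : a * e' = a) (G F : K) :
    rightMul K e * twistedRightMul a (arrowCocycle G F e a e') * rightMul K e' =
      twistedRightMul a (arrowCocycle G F e a e') := by
  refine MulOpposite.unop_injective (LinearMap.ext fun v => ?_)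
  simp only [MulOpposite.unop_mul, Module.End.mul_apply, rightMul_unop_apply,
    twistedRightMul_unop_apply, arrowCocycle_apply, dual_op_smul_apply, smul_smul]
  ext1
  · simp only [add_mul, sub_mul, smul_mul_assoc, mul_assoc, he.eq, he'.eq, hea, hae']
  · simp only [← MulOpposite.op_mul, hea, hae']

theorem twistedRightMul_mul_eq_zero {e a e' b e'' : Λ} (hae' : a * e' = a) (heb : e' * b = b)
    (hab : a * b = 0) (G F H : K) :
    twistedRightMul a (arrowCocycle G F e a e') * twistedRightMul b (arrowCocycle F H e' b e'') =
      0 := by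
  refine MulOpposite.unop_injective (LinearMap.ext fun v => ?_)
  simp only [MulOpposite.unop_mul, Module.End.mul_apply,
    twistedRightMul_unop_apply, arrowCocycle_apply, dual_op_smul_apply, smul_smul]
  ext1
  · simp [add_mul, sub_mul, mul_assoc, hab, hae', heb]
  · simp [← MulOpposite.op_mul, hab]

end RightMul

section TwistedRightRep

variable {K Q Λ : Type*} [Field K] [Quiver Q] [Fintype Q] [Ring Λ] [Algebra K Λ]
  (φ : PathAlgebra K Q →ₐ[K] Λ) (G F : Quiver.Total Q → K)

/-- The extension of the right `K Q`-module `Module.Dual K Λ` by the right `K Q`-module `Λ` whose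
cocycle takes the value `arrowCocycle (G α) (F α)` at an arrow `α`. -/
def twistedRightRep : PathAlgebra K Q →ₐ[K] (Module.End K (Λ × Module.Dual K Λ))ᵐᵒᵖ :=
  lift K (completeOrthogonalIdempotents_vertex.map ((rightMul K).comp φ).toRingHom)
    (a := fun x y α => twistedRightMul (φ (arrow K α)) (arrowCocycle (G ⟨x, y, α⟩) (F ⟨x, y, α⟩)
      (φ (vertex K x)) (φ (arrow K α)) (φ (vertex K y))))
    fun x y α => rightMul_mul_twistedRightMul_mul_rightMul
      ((completeOrthogonalIdempotents_vertex.idem x).map φ)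
      ((completeOrthogonalIdempotents_vertex.idem y).map φ)
      (by rw [← map_mul, vertex_mul_arrow]) (by rw [← map_mul, arrow_mul_vertex]) _ _

theorem twistedRightRep_vertex (x : Q) :
    twistedRightRep φ G F (vertex K x) = rightMul K (φ (vertex K x)) :=
  lift_vertex ..

theorem twistedRightRep_arrow {x y : Q} (α : x ⟶ y) :
    twistedRightRep φ G F (arrow K α) = twistedRightMul (φ (arrow K α))
      (arrowCocycle (G ⟨x, y, α⟩) (F ⟨x, y, α⟩) (φ (vertex K x)) (φ (arrow K α))
        (φ (vertex K y))) :=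
  lift_arrow ..

theorem twistedRightRep_unop_inl (p : PathAlgebra K Q) (l : Λ) :
    (twistedRightRep φ G F p).unop (l, 0) = (l * φ p, 0) := by
  induction p using generator_induction with
  | zero => simp only [map_zero, MulOpposite.unop_zero, LinearMap.zero_apply, mul_zero,
      Prod.mk_zero_zero]
  | add p q hp hq => simp [hp, hq, mul_add]
  | smul c p hp => simp [hp]
  | vertex x => simp [twistedRightRep_vertex, rightMul_unop_apply]
  | mul_arrow p α hp =>
    simp [hp, twistedRightRep_arrow, twistedRightMul_unop_apply, mul_assoc]

theorem twistedRightRep_unop_snd (p : PathAlgebra K Q) (v : Λ × Module.Dual K Λ) :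
    ((twistedRightRep φ G F p).unop v).2 = MulOpposite.op (φ p) • v.2 := by
  induction p using generator_induction with
  | zero => simp
  | add p q hp hq => simp [hp, hq, add_smul]
  | smul c p hp => simp [hp]
  | vertex x => simp [twistedRightRep_vertex, rightMul_unop_apply]
  | mul_arrow p α hp =>
    simp [hp, twistedRightRep_arrow, twistedRightMul_unop_apply, mul_smul]

variable {φ G F}

theorem ker_le_ker_twistedRightRep (hφ : IsQuadraticMonomial (TwoSidedIdeal.ker φ))
    (hGF : ∀ {x y z : Q} (α : x ⟶ y) (β : y ⟶ z), arrowMul K α β ∈ TwoSidedIdeal.ker φ →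
      G ⟨y, z, β⟩ = F ⟨x, y, α⟩) :
    TwoSidedIdeal.ker φ ≤ TwoSidedIdeal.ker (twistedRightRep φ G F) := by
  refine hφ.le_iff.2 fun x y z α β hαβ => ?_
  have hG := hGF α β hαβ
  rw [TwoSidedIdeal.mem_ker, ← arrow_mul_arrow, map_mul] at hαβ ⊢
  rw [twistedRightRep_arrow, twistedRightRep_arrow, hG]
  exact twistedRightMul_mul_eq_zero (by rw [← map_mul, arrow_mul_vertex])
    (by rw [← map_mul, vertex_mul_arrow]) hαβ _ _ _

end TwistedRightRep

theorem InjProjExtensionsSplit.exists_arrowCocycle_splitting {K Q : Type*} {Λ : Type w} [Field K]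
    [Quiver Q] [Fintype Q] [Ring Λ] [Algebra K Λ] [Module.Finite K Λ] [IsNoetherianRing Λᵐᵒᵖ]
    (hsplit : InjProjExtensionsSplit (FGModuleCat.{w} Λᵐᵒᵖ)) {φ : PathAlgebra K Q →ₐ[K] Λ}
    (hφ : Function.Surjective φ) (hker : IsQuadraticMonomial (TwoSidedIdeal.ker φ))
    {G F : Quiver.Total Q → K}
    (hGF : ∀ {x y z : Q} (α : x ⟶ y) (β : y ⟶ z), arrowMul K α β ∈ TwoSidedIdeal.ker φ →
      G ⟨y, z, β⟩ = F ⟨x, y, α⟩) :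
    ∃ t : Module.Dual K Λ →+ Λ, ∀ {x y : Q} (α : x ⟶ y) (m : Module.Dual K Λ),
      t (MulOpposite.op (φ (arrow K α)) • m) = t m * φ (arrow K α) +
        arrowCocycle (G ⟨x, y, α⟩) (F ⟨x, y, α⟩) (φ (vertex K x)) (φ (arrow K α))
          (φ (vertex K y)) m := by
  obtain ⟨θ, hθ⟩ := exists_algHom_comp_eq_of_ker_le
    (C := (Module.End K (Λ × Module.Dual K Λ))ᵐᵒᵖ) hφ (twistedRightRep φ G F)
    (ker_le_ker_twistedRightRep hker hGF)
  have θ_inl : ∀ a l : Λ, (θ a).unop (l, 0) = (l * a, 0) := hφ.forall.2 fun p l => by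
    rw [hθ, twistedRightRep_unop_inl]
  have θ_snd : ∀ (a : Λ) (v), ((θ a).unop v).2 = MulOpposite.op a • v.2 := hφ.forall.2 fun p v => by
    rw [hθ, twistedRightRep_unop_snd]
  have := dual_finite (K := K) (Λ := Λ)
  let unopEquiv : Λᵐᵒᵖ ≃ₗ[K] Λ := (MulOpposite.opLinearEquiv K).symm
  obtain ⟨s, hs, hsθ⟩ := hsplit.exists_equivariant_section (A := Λᵐᵒᵖ) (dual_baer (K := K))
    (AlgHom.opComm θ).toRingHom
    (f := (LinearMap.inl K Λ (Module.Dual K Λ) ∘ₗ unopEquiv.toLinearMap).toAddMonoidHom)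
    (g := (LinearMap.snd K Λ (Module.Dual K Λ)).toAddMonoidHom)
    (LinearMap.inl_injective.comp unopEquiv.injective) Prod.snd_surjective
    (unopEquiv.precomp_exact_iff_exact.2 Function.Exact.inl_snd)
    (fun r l => (θ_inl r.unop l.unop).symm) fun r v => θ_snd r.unop v
  refine ⟨(AddMonoidHom.fst Λ (Module.Dual K Λ)).comp s, fun {x y} α m => ?_⟩
  have fst_θ (v) : ((θ (φ (arrow K α))).unop v).1 = v.1 * φ (arrow K α) +
      arrowCocycle (G ⟨x, y, α⟩) (F ⟨x, y, α⟩) (φ (vertex K x)) (φ (arrow K α))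
        (φ (vertex K y)) v.2 := by
    rw [hθ, twistedRightRep_arrow, twistedRightMul_unop_apply]
  have hsα := congrArg Prod.fst (hsθ (MulOpposite.op (φ (arrow K α))) m)
  exact (hsα.trans (fst_θ (s m))).trans (by rw [show (s m).2 = m from hs m]; rfl)

end Extension

open DualNumber

section AdjacencyJet

variable (K Q : Type*) [Field K] [Quiver Q] [Fintype Q] [DecidableEq Q]

/-- The adjacency representation of `K Q` in matrices over the dual numbers, which sends the arrow
`x ⟶ y` to `ε` times the elementary matrix at `(x, y)`. It detects paths of length at most one. -/
def adjacencyJet : PathAlgebra K Q →ₐ[K] Matrix Q Q K[ε] :=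
  lift K (e := fun x => Matrix.single x x 1) (a := fun x y _ => Matrix.single x y ε)
    { idem := fun x => by simp [IsIdempotentElem]
      ortho := fun x y h => by simp [h]
      complete := Matrix.sum_single_one }
    fun x y _ => by simp

variable {K Q}

theorem adjacencyJet_vertex (x : Q) : adjacencyJet K Q (vertex K x) = Matrix.single x x 1 :=
  lift_vertex ..

theorem adjacencyJet_arrow {x y : Q} (α : x ⟶ y) :
    adjacencyJet K Q (arrow K α) = Matrix.single x y ε :=
  lift_arrow ..

theorem arrowIdealPow_two_le_ker_adjacencyJet :
    arrowIdealPow K Q 2 ≤ TwoSidedIdeal.ker (adjacencyJet K Q) :=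
  arrowIdealPow_two_le_iff.2 fun x y z α β => by
    rw [TwoSidedIdeal.mem_ker, ← arrow_mul_arrow, map_mul, adjacencyJet_arrow, adjacencyJet_arrow,
      Matrix.single_mul_single_same, eps_mul_eps, Matrix.single_zero]

end AdjacencyJet

section Potential

attribute [local instance] dualRightModule

theorem exists_adjacencyJet_factorization {K Q Λ : Type*} [Field K] [Quiver Q] [Fintype Q]
    [DecidableEq Q] [Ring Λ] [Algebra K Λ] {φ : PathAlgebra K Q →ₐ[K] Λ}
    (hφ : Function.Surjective φ) (hker : TwoSidedIdeal.ker φ ≤ arrowIdealPow K Q 2) :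
    ∃ μ : Λ →ₐ[K] Matrix Q Q K[ε], (∀ x : Q, μ (φ (vertex K x)) = Matrix.single x x 1) ∧
      ∀ {x y : Q} (α : x ⟶ y), μ (φ (arrow K α)) = Matrix.single x y ε := by
  obtain ⟨μ, hμ⟩ := exists_algHom_comp_eq_of_ker_le hφ (adjacencyJet K Q)
    (hker.trans arrowIdealPow_two_le_ker_adjacencyJet)
  exact ⟨μ, fun x => by rw [hμ, adjacencyJet_vertex], fun α => by rw [hμ, adjacencyJet_arrow]⟩

theorem exists_vertex_potential_of_arrowCocycle_splitting {K Q Λ : Type*} [Field K] [Quiver Q]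
    [Fintype Q] [Ring Λ] [Algebra K Λ] {φ : PathAlgebra K Q →ₐ[K] Λ}
    (hφ : Function.Surjective φ) (hker : TwoSidedIdeal.ker φ ≤ arrowIdealPow K Q 2)
    {G F : Quiver.Total Q → K} (t : Module.Dual K Λ →+ Λ)
    (ht : ∀ {x y : Q} (α : x ⟶ y) (m : Module.Dual K Λ),
      t (MulOpposite.op (φ (arrow K α)) • m) = t m * φ (arrow K α) +
        arrowCocycle (G ⟨x, y, α⟩) (F ⟨x, y, α⟩) (φ (vertex K x)) (φ (arrow K α))
          (φ (vertex K y)) m) :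
    ∃ c : Q → K, ∀ {x y : Q} (α : x ⟶ y), G ⟨x, y, α⟩ = c x ∧ F ⟨x, y, α⟩ = c y := by
  classical
  obtain ⟨μ, μ_vertex, μ_arrow⟩ := exists_adjacencyJet_factorization hφ hker
  let χ (x : Q) : Module.Dual K Λ :=
    (TrivSqZeroExt.fstHom K K K).toLinearMap ∘ₗ Matrix.entryLinearMap K _ x x ∘ₗ μ.toLinearMap
  let δ (x y : Q) : Module.Dual K Λ :=
    TrivSqZeroExt.sndHom K K ∘ₗ Matrix.entryLinearMap K _ x y ∘ₗ μ.toLinearMap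
  have χ_apply (x a) : χ x a = (μ a x x).fst := rfl
  have δ_apply (x y a) : δ x y a = (μ a x y).snd := rfl
  have χ_vertex (x) : χ x (φ (vertex K x)) = 1 := by simp [χ_apply, μ_vertex]
  have δ_vertex (x y z) : δ x y (φ (vertex K z)) = 0 := by
    simp [δ_apply, μ_vertex, Matrix.single_apply, apply_ite TrivSqZeroExt.snd]
  refine ⟨fun x => -χ x (t (χ x)), fun {x y} α => ?_⟩
  have χ_arrow (z) : χ z (φ (arrow K α)) = 0 := by
    simp [χ_apply, μ_arrow, Matrix.single_apply, apply_ite TrivSqZeroExt.fst]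
  have χ_mul_arrow (a) : χ y (a * φ (arrow K α)) = 0 := by simp [χ_apply, μ_arrow]
  have δ_arrow : δ x y (φ (arrow K α)) = 1 := by simp [δ_apply, μ_arrow]
  have δ_mul_arrow (a) : δ x y (a * φ (arrow K α)) = χ x a := by simp [δ_apply, χ_apply, μ_arrow]
  have arrow_smul_χ : MulOpposite.op (φ (arrow K α)) • χ x = 0 := by
    ext b
    simp [dual_op_smul_apply, χ_apply, μ_arrow]
  have arrow_smul_δ : MulOpposite.op (φ (arrow K α)) • δ x y = χ y := by
    ext b
    simp [dual_op_smul_apply, χ_apply, δ_apply, μ_arrow]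
  -- The cocycle identity at `χ x`, read off along `α`, gives `G α`; at `δ x y`, read off at the
  -- vertex `y`, it gives `F α`.
  constructor
  · have h := congrArg (δ x y) (ht α (χ x))
    simp only [arrow_smul_χ, arrowCocycle_apply, χ_vertex, χ_arrow, one_smul, zero_smul, smul_zero,
      sub_zero, map_zero, map_add, δ_mul_arrow, map_smul, δ_arrow, smul_eq_mul, mul_one] at h
    exact eq_neg_of_add_eq_zero_right h.symm
  · have h := congrArg (χ y) (ht α (δ x y))
    simp only [arrow_smul_δ, arrowCocycle_apply, δ_vertex, δ_arrow, one_smul, zero_smul, smul_zero,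
      zero_sub, map_add, map_neg, χ_mul_arrow, map_smul, χ_vertex, smul_eq_mul, mul_one,
      zero_add] at h
    exact neg_eq_iff_eq_neg.1 h.symm

/-- Every pair of arrow weights `G`, `F` that is compatible with the zero relations in `I` is given
by a single vertex weight `c`, with `G` its value at the source and `F` its value at the target. It
records that the extensions of `D Λ` by `Λ` defined by such weights split, for `Λ = K Q / I`. -/
def HasVertexPotentials {K Q : Type*} [Field K] [Quiver Q] [Fintype Q]
    (I : TwoSidedIdeal (PathAlgebra K Q)) : Prop :=
  ∀ G F : Quiver.Total Q → K,
    (∀ {x y z : Q} (α : x ⟶ y) (β : y ⟶ z), arrowMul K α β ∈ I → G ⟨y, z, β⟩ = F ⟨x, y, α⟩) →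
    ∃ c : Q → K, ∀ {x y : Q} (α : x ⟶ y), G ⟨x, y, α⟩ = c x ∧ F ⟨x, y, α⟩ = c y

theorem InjProjExtensionsSplit.hasVertexPotentials {K Q : Type*} {Λ : Type w} [Field K] [Quiver Q]
    [Fintype Q] [Ring Λ] [Algebra K Λ] [Module.Finite K Λ] [IsNoetherianRing Λᵐᵒᵖ]
    (hsplit : InjProjExtensionsSplit (FGModuleCat.{w} Λᵐᵒᵖ)) {φ : PathAlgebra K Q →ₐ[K] Λ}
    (hφ : Function.Surjective φ) (hker : IsQuadraticMonomial (TwoSidedIdeal.ker φ)) :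
    HasVertexPotentials (TwoSidedIdeal.ker φ) := by
  intro G F hGF
  obtain ⟨t, ht⟩ := hsplit.exists_arrowCocycle_splitting hφ hker hGF
  exact exists_vertex_potential_of_arrowCocycle_splitting hφ hker.le_arrowIdealPow_two t ht

end Potential

namespace HasVertexPotentials

variable {K Q : Type*} [Field K] [Quiver Q] [Fintype Q] {I : TwoSidedIdeal (PathAlgebra K Q)}

open Classical in
theorem exists_potential_of_starting_weight (hI : HasVertexPotentials I)
    (right_zero : ∀ {x y : Q} (α : x ⟶ y),
      {β : Quiver.Star y | arrowMul K α β.2 ∈ I}.Subsingleton) (G : Quiver.Total Q → K) :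
    ∃ c : Q → K, (∀ {x y : Q} (α : x ⟶ y), G ⟨x, y, α⟩ = c x) ∧
      ∀ {x y : Q} (α : x ⟶ y), (∀ β : Quiver.Star y, arrowMul K α β.2 ∉ I) → c y = 0 := by
  let F (α : Quiver.Total Q) : K :=
    if h : ∃ β : Quiver.Star α.right, arrowMul K α.hom β.2 ∈ I then G ⟨_, _, h.choose.2⟩ else 0
  obtain ⟨c, hc⟩ := hI G F fun {x y z} α β hαβ => by
    have h : ∃ β : Quiver.Star y, arrowMul K α β.2 ∈ I := ⟨⟨z, β⟩, hαβ⟩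
    have hβ : h.choose = ⟨z, β⟩ := right_zero α h.choose_spec hαβ
    have F_eq : F ⟨x, y, α⟩ = G ⟨_, _, h.choose.2⟩ := dif_pos h
    rw [F_eq]
    exact congrArg (fun β : Quiver.Star y => G ⟨y, _, β.2⟩) hβ.symm
  refine ⟨c, fun α => (hc α).1, fun α hα => ?_⟩
  rw [← (hc α).2]
  exact dif_neg (not_exists.2 hα)

open Classical in
theorem exists_potential_of_ending_weight (hI : HasVertexPotentials I)
    (left_zero : ∀ {x y : Q} (α : x ⟶ y),
      {γ : Quiver.Costar x | arrowMul K γ.2 α ∈ I}.Subsingleton) (F : Quiver.Total Q → K) :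
    ∃ c : Q → K, ∀ {x y : Q} (α : x ⟶ y), F ⟨x, y, α⟩ = c y := by
  let G (α : Quiver.Total Q) : K :=
    if h : ∃ γ : Quiver.Costar α.left, arrowMul K γ.2 α.hom ∈ I then F ⟨_, _, h.choose.2⟩ else 0
  obtain ⟨c, hc⟩ := hI G F fun {x y z} γ α hγα => by
    have h : ∃ γ : Quiver.Costar y, arrowMul K γ.2 α ∈ I := ⟨⟨x, γ⟩, hγα⟩
    have hγ : h.choose = ⟨x, γ⟩ := left_zero α h.choose_spec hγα
    have G_eq : G ⟨y, z, α⟩ = F ⟨_, _, h.choose.2⟩ := dif_pos h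
    rw [G_eq]
    exact congrArg (fun γ : Quiver.Costar y => F ⟨_, y, γ.2⟩) hγ
  exact ⟨c, fun α => (hc α).2⟩

theorem subsingleton_star (hI : HasVertexPotentials I)
    (right_zero : ∀ {x y : Q} (α : x ⟶ y),
      {β : Quiver.Star y | arrowMul K α β.2 ∈ I}.Subsingleton) (x : Q) :
    Subsingleton (Quiver.Star x) := by
  classical
  refine ⟨fun ⟨y, α⟩ ⟨y', α'⟩ => ?_⟩
  obtain ⟨c, hc, -⟩ := hI.exists_potential_of_starting_weight right_zero
    (Pi.single ⟨x, y, α⟩ 1)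
  have hα : (⟨x, y', α'⟩ : Quiver.Total Q) = ⟨x, y, α⟩ := by
    by_contra hne
    simpa [hne] using (hc α).trans (hc α').symm
  cases hα
  rfl

theorem subsingleton_costar (hI : HasVertexPotentials I)
    (left_zero : ∀ {x y : Q} (α : x ⟶ y),
      {γ : Quiver.Costar x | arrowMul K γ.2 α ∈ I}.Subsingleton) (y : Q) :
    Subsingleton (Quiver.Costar y) := by
  classical
  refine ⟨fun ⟨x, α⟩ ⟨x', α'⟩ => ?_⟩
  obtain ⟨c, hc⟩ := hI.exists_potential_of_ending_weight left_zero (Pi.single ⟨x, y, α⟩ 1)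
  have hα : (⟨x', y, α'⟩ : Quiver.Total Q) = ⟨x, y, α⟩ := by
    by_contra hne
    simpa [hne] using (hc α).trans (hc α').symm
  cases hα
  rfl

theorem arrowIdealPow_two_le (hI : HasVertexPotentials I)
    (right_zero : ∀ {x y : Q} (α : x ⟶ y),
      {β : Quiver.Star y | arrowMul K α β.2 ∈ I}.Subsingleton) : arrowIdealPow K Q 2 ≤ I := by
  refine arrowIdealPow_two_le_iff.2 fun x y z α β => ?_
  obtain ⟨c, hc, hc0⟩ := hI.exists_potential_of_starting_weight right_zero 1
  by_contra hαβ
  refine one_ne_zero ((hc β).trans (hc0 α fun β' => ?_))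
  have := hI.subsingleton_star right_zero y
  rwa [Subsingleton.elim β' ⟨z, β⟩]

end HasVertexPotentials

section Connected

variable {K Q : Type*} [Field K] [Quiver Q] [Fintype Q]

theorem PathAlgebra.commute_sum_vertex {s : Finset Q}
    (hs : ∀ {x y : Q}, (x ⟶ y) → (x ∈ s ↔ y ∈ s)) (a : PathAlgebra K Q) :
    Commute a (∑ x ∈ s, vertex K x) := by
  have he := completeOrthogonalIdempotents_vertex (K := K) (Q := Q)
  have commute_vertex (x) : Commute (vertex K x) (∑ y ∈ s, vertex K y) := by
    classical
    simp [commute_iff_eq, Finset.mul_sum, Finset.sum_mul, he.mul_eq]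
  induction a using generator_induction with
  | zero => exact Commute.zero_left _
  | add a b ha hb => exact ha.add_left hb
  | smul c a ha => exact ha.smul_left c
  | vertex x => exact commute_vertex x
  | @mul_arrow a x y α ha =>
    refine ha.mul_left ?_
    have arrow_mul : arrow K α * ∑ z ∈ s, vertex K z =
        arrow K α * (vertex K y * ∑ z ∈ s, vertex K z) := by rw [← mul_assoc, arrow_mul_vertex]
    have mul_arrow : (∑ z ∈ s, vertex K z) * arrow K α =
        (vertex K x * ∑ z ∈ s, vertex K z) * arrow K α := by
      rw [(commute_vertex x).eq, mul_assoc, vertex_mul_arrow]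
    rw [commute_iff_eq, arrow_mul, mul_arrow]
    by_cases hx : x ∈ s
    · rw [he.mul_sum_of_mem hx, he.mul_sum_of_mem ((hs α).1 hx), vertex_mul_arrow, arrow_mul_vertex]
    · rw [he.mul_sum_of_notMem hx, he.mul_sum_of_notMem (mt (hs α).2 hx), zero_mul, mul_zero]

theorem IsConnectedRing.eq_empty_or_eq_univ {Λ : Type*} [Ring Λ] [Algebra K Λ]
    (hΛ : IsConnectedRing Λ) {φ : PathAlgebra K Q →ₐ[K] Λ}
    (hφ : Function.Surjective φ) (hker : TwoSidedIdeal.ker φ ≤ arrowIdealPow K Q 2) {s : Finset Q}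
    (hs : ∀ {x y : Q}, (x ⟶ y) → (x ∈ s ↔ y ∈ s)) : s = ∅ ∨ s = Finset.univ := by
  classical
  obtain ⟨μ, μ_vertex, -⟩ := exists_adjacencyJet_factorization hφ hker
  have vertex_ne_zero (x : Q) : φ (vertex K x) ≠ 0 := fun h => by
    simpa [h] using congrFun₂ (μ_vertex x) x x
  have he := completeOrthogonalIdempotents_vertex (K := K) (Q := Q)
  obtain h | h := hΛ.2 (φ (∑ x ∈ s, vertex K x))
    (Subring.mem_center_iff.2 <| hφ.forall.2 fun a => ((commute_sum_vertex hs a).map φ).eq)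
    (he.isIdempotentElem_sum.map φ)
  · refine .inl (Finset.eq_empty_of_forall_notMem fun x hx => vertex_ne_zero x ?_)
    rw [← he.mul_sum_of_mem hx, map_mul, h, mul_zero]
  · refine .inr (Finset.eq_univ_of_forall fun x => ?_)
    by_contra hx
    apply vertex_ne_zero x
    rw [← mul_one (φ _), ← h, ← map_mul, he.mul_sum_of_notMem hx, map_zero]

theorem PathAlgebra.nonempty_of_algHom {Λ : Type*} [Ring Λ] [Nontrivial Λ] [Algebra K Λ]
    (φ : PathAlgebra K Q →ₐ[K] Λ) : Nonempty Q := by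
  by_contra hQ
  rw [not_nonempty_iff] at hQ
  exact one_ne_zero (α := Λ) (by
    rw [← map_one φ, one_def, Finset.univ_eq_empty, Finset.sum_empty, map_zero])

end Connected

section PartialPermutation

variable {V : Type*} {r : V → V → Prop}

theorem exists_perm_of_biUnique [Finite V] (hr : Relator.BiUnique r) :
    ∃ π : Equiv.Perm V, ∀ x y, r x y → π x = y := by
  classical
  have := Fintype.ofFinite V
  obtain _ | _ := isEmpty_or_nonempty V
  · exact ⟨1, fun x => isEmptyElim x⟩
  choose! f hf using fun (x : V) (h : ∃ y, r x y) => h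
  have f_injOn : Set.InjOn f {x | ∃ y, r x y} := fun x hx x' hx' h =>
    hr.1 (hf x hx) (h ▸ hf x' hx')
  obtain ⟨g, hg⟩ := Set.MapsTo.exists_equiv_extend_of_card_eq (t := Finset.univ)
    Finset.card_univ.symm (fun x _ => Finset.mem_coe.2 (Finset.mem_univ (f x))) f_injOn
  exact ⟨g.trans (Equiv.subtypeUnivEquiv Finset.mem_univ), fun x y hxy =>
    (hg x ⟨y, hxy⟩).trans (hr.2 (hf x ⟨y, hxy⟩) hxy)⟩

theorem exists_equiv_fin_of_isCycleOn [Finite V] {π : Equiv.Perm V}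
    (hπ : π.IsCycleOn Set.univ) (x₀ : V) :
    ∃ (n : ℕ) (σ : Fin (n + 1) ≃ V), σ 0 = x₀ ∧
      ∀ i j, π (σ i) = σ j ↔ (i.val + 1) % (n + 1) = j.val := by
  have := Fintype.ofFinite V
  obtain ⟨n, hn⟩ := Nat.exists_eq_succ_of_ne_zero (Fintype.card_pos_iff.2 ⟨x₀⟩).ne'
  have hπ' : π.IsCycleOn (Finset.univ : Finset V) := by rwa [Finset.coe_univ]
  have pow_surjective : Function.Surjective fun i : Fin (n + 1) => (π ^ i.val) x₀ := fun y => by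
    obtain ⟨k, hk, rfl⟩ := hπ'.exists_pow_eq (Finset.mem_univ x₀) (Finset.mem_univ y)
    exact ⟨⟨k, hk.trans_eq hn⟩, rfl⟩
  refine ⟨n, Equiv.ofBijective _ ((Fintype.bijective_iff_surjective_and_card _).2
    ⟨pow_surjective, (Fintype.card_fin _).trans hn.symm⟩), rfl, fun i j => ?_⟩
  change π ((π ^ i.val) x₀) = (π ^ j.val) x₀ ↔ _
  rw [← Equiv.Perm.mul_apply, ← pow_succ', hπ'.pow_apply_eq_pow_apply (Finset.mem_univ x₀),
    Finset.card_univ, hn, Nat.ModEq, Nat.mod_eq_of_lt j.isLt]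

variable [Fintype V]
  (hclosed : ∀ s : Finset V, (∀ {x y}, r x y → (x ∈ s ↔ y ∈ s)) → s = ∅ ∨ s = Finset.univ)

include hclosed

theorem isCycleOn_of_forall_closed {π : Equiv.Perm V} (hπ : ∀ x y, r x y → π x = y) :
    π.IsCycleOn Set.univ := by
  classical
  refine ⟨Set.bijOn_univ.2 π.bijective, fun x _ y _ => ?_⟩
  obtain h | h := hclosed {y | π.SameCycle x y} fun {y z} hyz => by
    simp [← hπ y z hyz]
  · exact absurd (Equiv.Perm.SameCycle.refl π x) (by simpa using Finset.ext_iff.1 h x)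
  · simpa using Finset.ext_iff.1 h y

theorem rel_iff_succ_of_not_rel_last {n : ℕ} (σ : Fin (n + 1) ≃ V)
    (hr : ∀ i j, r (σ i) (σ j) → (i.val + 1) % (n + 1) = j.val)
    (hlast : ¬ r (σ (Fin.last n)) (σ 0)) (i j : Fin (n + 1)) :
    r (σ i) (σ j) ↔ i.val + 1 = j.val := by
  have succ_of_rel {i j} (hij : r (σ i) (σ j)) : i.val + 1 = j.val := by
    have hlt : i.val + 1 < n + 1 := by
      by_contra hi
      have hi : i = Fin.last n := Fin.ext (by grind)
      have hj : j = 0 := Fin.ext (by simp [← hr i j hij, hi])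
      exact hlast (hi ▸ hj ▸ hij)
    rw [← hr i j hij, Nat.mod_eq_of_lt hlt]
  refine ⟨succ_of_rel, fun hij => ?_⟩
  -- Otherwise the vertices up to `σ i` would be closed under `r` in both directions.
  by_contra hσ
  obtain h | h := hclosed ((Finset.Iic i).map σ.toEmbedding) fun {x y} hxy => by
    obtain ⟨a, rfl⟩ := σ.surjective x
    obtain ⟨b, rfl⟩ := σ.surjective y
    have hab := succ_of_rel hxy
    have hai : a ≠ i := by
      rintro rfl
      exact hσ (Fin.ext (hab.symm.trans hij) ▸ hxy)
    simp only [Finset.mem_map_equiv, Equiv.symm_apply_apply, Finset.mem_Iic, Fin.le_def]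
    grind
  · exact (Finset.nonempty_Iic.map (f := σ.toEmbedding)).ne_empty h
  · have hlast_mem := Finset.ext_iff.1 h (σ (Fin.last n))
    simp only [Finset.mem_map_equiv, Equiv.symm_apply_apply, Finset.mem_Iic, Finset.mem_univ,
      iff_true, Fin.last_le_iff] at hlast_mem
    grind

theorem exists_enumeration_linear_or_cyclic [Nonempty V] (hr : Relator.BiUnique r) :
    (∃ n : ℕ, 1 ≤ n ∧ ∃ σ : Fin n ≃ V, ∀ i j, r (σ i) (σ j) ↔ i.val + 1 = j.val) ∨
      ∃ (n : ℕ) (σ : Fin (n + 1) ≃ V), ∀ i j, r (σ i) (σ j) ↔ (i.val + 1) % (n + 1) = j.val := by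
  obtain ⟨π, hπ⟩ := exists_perm_of_biUnique hr
  have hcycle := isCycleOn_of_forall_closed hclosed hπ
  by_cases hall : ∀ x, r x (π x)
  · obtain ⟨n, σ, -, hσ⟩ := exists_equiv_fin_of_isCycleOn hcycle (Classical.arbitrary V)
    refine .inr ⟨n, σ, fun i j => ?_⟩
    rw [← hσ]
    exact ⟨hπ _ _, fun h => h ▸ hall _⟩
  · push Not at hall
    obtain ⟨x, hx⟩ := hall
    obtain ⟨n, σ, σ_zero, hσ⟩ := exists_equiv_fin_of_isCycleOn hcycle (π x)
    have σ_last : σ (Fin.last n) = x :=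
      π.injective (((hσ (Fin.last n) 0).2 (by simp)).trans σ_zero)
    refine .inl ⟨n + 1, n.succ_pos, σ, rel_iff_succ_of_not_rel_last hclosed σ
      (fun i j hij => (hσ i j).1 (hπ _ _ hij)) ?_⟩
    rwa [σ_last, σ_zero]

end PartialPermutation

theorem exists_surjective_algHom_ker_eq {K A Λ : Type*} [Field K] [Ring A] [Ring Λ] [Algebra K A]
    [Algebra K Λ] {I : TwoSidedIdeal A} (e : Λ ≃ₐ[K] I.ringCon.Quotient) :
    ∃ φ : A →ₐ[K] Λ, Function.Surjective φ ∧ TwoSidedIdeal.ker φ = I := by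
  refine ⟨e.symm.toAlgHom.comp (I.ringCon.mkₐ K), e.symm.surjective.comp I.ringCon.mk'_surjective,
    ?_⟩
  have ker_mk : TwoSidedIdeal.ker (I.ringCon.mkₐ K) = I := TwoSidedIdeal.ker_ringCon_mk' I
  ext a
  rw [TwoSidedIdeal.mem_ker, ← TwoSidedIdeal.ext_iff.1 ker_mk a, TwoSidedIdeal.mem_ker]
  exact map_eq_zero_iff e.symm e.symm.injective

section RadSqZero

variable {K Q Q' : Type*} [Field K] [Quiver Q] [Fintype Q] [Quiver Q'] [Fintype Q']

variable (K Q) in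
/-- The projection of `K Q` onto `K Q / J ^ 2`. -/
abbrev toRadSqZero : PathAlgebra K Q →ₐ[K] RadSqZeroPathAlgebra K Q :=
  (arrowIdealPow K Q 2).ringCon.mkₐ K

theorem toRadSqZero_surjective : Function.Surjective (toRadSqZero K Q) :=
  (arrowIdealPow K Q 2).ringCon.mk'_surjective

theorem ker_toRadSqZero : TwoSidedIdeal.ker (toRadSqZero K Q) = arrowIdealPow K Q 2 :=
  TwoSidedIdeal.ker_ringCon_mk' _

theorem radSqZero_algHom_ext {A : Type*} [Ring A] [Algebra K A]
    {f g : RadSqZeroPathAlgebra K Q →ₐ[K] A}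
    (hvertex : ∀ x, f (toRadSqZero K Q (vertex K x)) = g (toRadSqZero K Q (vertex K x)))
    (harrow : ∀ {x y : Q} (α : x ⟶ y),
      f (toRadSqZero K Q (arrow K α)) = g (toRadSqZero K Q (arrow K α))) : f = g :=
  (AlgHom.cancel_right toRadSqZero_surjective).1 (algHom_ext hvertex fun _ _ => harrow)

theorem exists_radSqZero_algHom (σ : Q ≃ Q') (f : ∀ {x y : Q}, (x ⟶ y) → (σ x ⟶ σ y)) :
    ∃ F : RadSqZeroPathAlgebra K Q →ₐ[K] RadSqZeroPathAlgebra K Q',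
      (∀ x, F (toRadSqZero K Q (vertex K x)) = toRadSqZero K Q' (vertex K (σ x))) ∧
      ∀ {x y : Q} (α : x ⟶ y),
        F (toRadSqZero K Q (arrow K α)) = toRadSqZero K Q' (arrow K (f α)) := by
  let pathMap : PathAlgebra K Q →ₐ[K] PathAlgebra K Q' :=
    lift K ((CompleteOrthogonalIdempotents.equiv σ).2 completeOrthogonalIdempotents_vertex)
      (a := fun _ _ α => arrow K (f α)) fun x y α => by
        rw [Function.comp_apply, Function.comp_apply, vertex_mul_arrow, arrow_mul_vertex]
  have pathMap_arrow {x y : Q} (α : x ⟶ y) : pathMap (arrow K α) = arrow K (f α) := lift_arrow ..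
  have hker : TwoSidedIdeal.ker (toRadSqZero K Q) ≤
      TwoSidedIdeal.ker ((toRadSqZero K Q').comp pathMap) := by
    rw [ker_toRadSqZero]
    refine arrowIdealPow_two_le_iff.2 fun x y z α β => ?_
    have hmem := arrowMul_mem_arrowIdealPow_two (K := K) (f α) (f β)
    rw [← ker_toRadSqZero, ← arrow_mul_arrow, TwoSidedIdeal.mem_ker] at hmem
    rw [TwoSidedIdeal.mem_ker, AlgHom.comp_apply, ← arrow_mul_arrow, map_mul pathMap, pathMap_arrow,
      pathMap_arrow, hmem]
  obtain ⟨F, hF⟩ := exists_algHom_comp_eq_of_ker_le toRadSqZero_surjective _ hker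
  refine ⟨F, fun x => ?_, fun α => ?_⟩
  · rw [hF, AlgHom.comp_apply, lift_vertex, Function.comp_apply]
  · rw [hF, AlgHom.comp_apply, pathMap_arrow]

theorem nonempty_radSqZero_algEquiv [Quiver.IsThin Q] [Quiver.IsThin Q'] (σ : Q ≃ Q')
    (hσ : ∀ x y, Nonempty (x ⟶ y) ↔ Nonempty (σ x ⟶ σ y)) :
    Nonempty (RadSqZeroPathAlgebra K Q ≃ₐ[K] RadSqZeroPathAlgebra K Q') := by
  obtain ⟨F, F_vertex, F_arrow⟩ := exists_radSqZero_algHom (K := K) σ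
    fun α => ((hσ _ _).1 ⟨α⟩).some
  obtain ⟨F', F'_vertex, F'_arrow⟩ := exists_radSqZero_algHom (K := K) σ.symm
    fun {x y} α => ((hσ (σ.symm x) (σ.symm y)).2 (by simpa using ⟨α⟩)).some
  refine ⟨AlgEquiv.ofAlgHom F F' (radSqZero_algHom_ext (fun x => ?_) fun {x y} α => ?_)
    (radSqZero_algHom_ext (fun x => ?_) fun {x y} α => ?_)⟩
  · simp only [AlgHom.comp_apply, F'_vertex, F_vertex, σ.apply_symm_apply, AlgHom.id_apply]
  · rw [AlgHom.comp_apply, F'_arrow, F_arrow, AlgHom.id_apply]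
    exact congrArg _ (arrow_congr (σ.apply_symm_apply x) (σ.apply_symm_apply y) _ _)
  · simp only [AlgHom.comp_apply, F'_vertex, F_vertex, σ.symm_apply_apply, AlgHom.id_apply]
  · rw [AlgHom.comp_apply, F_arrow, F'_arrow, AlgHom.id_apply]
    exact congrArg _ (arrow_congr (σ.symm_apply_apply x) (σ.symm_apply_apply y) _ _)

end RadSqZero

theorem linearQuiver_isThin (n : ℕ) : Quiver.IsThin (LinearQuiver n) := fun _ _ =>
  inferInstanceAs (Subsingleton (PLift _))

theorem cyclicQuiver_isThin (n : ℕ) : Quiver.IsThin (CyclicQuiver n) := fun _ _ =>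
  inferInstanceAs (Subsingleton (PLift _))

theorem isRadSqZeroNakayama_radSqZeroPathAlgebra {K Q : Type*} [Field K] [Quiver Q] [Fintype Q]
    [Nonempty Q] (hstar : ∀ x : Q, Subsingleton (Quiver.Star x))
    (hcostar : ∀ y : Q, Subsingleton (Quiver.Costar y))
    (hclosed : ∀ s : Finset Q, (∀ {x y : Q}, (x ⟶ y) → (x ∈ s ↔ y ∈ s)) →
      s = ∅ ∨ s = Finset.univ) :
    IsRadSqZeroNakayama K (RadSqZeroPathAlgebra K Q) := by
  have : Quiver.IsThin Q := fun x y => ⟨fun α β =>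
    eq_of_heq (Sigma.mk.inj (Subsingleton.elim (⟨y, α⟩ : Quiver.Star x) ⟨y, β⟩)).2⟩
  have hr : Relator.BiUnique fun x y : Q => Nonempty (x ⟶ y) :=
    ⟨fun x y z ⟨α⟩ ⟨β⟩ => congrArg Sigma.fst (Subsingleton.elim (⟨x, α⟩ : Quiver.Costar z) ⟨y, β⟩),
      fun x y z ⟨α⟩ ⟨β⟩ => congrArg Sigma.fst (Subsingleton.elim (⟨y, α⟩ : Quiver.Star x) ⟨z, β⟩)⟩
  obtain ⟨n, hn, σ, hσ⟩ | ⟨n, σ, hσ⟩ :=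
    exists_enumeration_linear_or_cyclic (fun s hs => hclosed s fun α => hs ⟨α⟩) hr
  · have := linearQuiver_isThin n
    let τ : Q ≃ LinearQuiver n := σ.symm
    refine .inl ⟨n, hn, nonempty_radSqZero_algEquiv τ fun x y => ?_⟩
    obtain ⟨i, rfl⟩ := σ.surjective x
    obtain ⟨j, rfl⟩ := σ.surjective y
    rw [hσ, show τ (σ i) = i from σ.symm_apply_apply i, show τ (σ j) = j from σ.symm_apply_apply j]
    exact ⟨fun h => ⟨⟨h⟩⟩, fun ⟨⟨h⟩⟩ => h⟩
  · have := cyclicQuiver_isThin n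
    let τ : Q ≃ CyclicQuiver n := σ.symm
    refine .inr ⟨n, nonempty_radSqZero_algEquiv τ fun x y => ?_⟩
    obtain ⟨i, rfl⟩ := σ.surjective x
    obtain ⟨j, rfl⟩ := σ.surjective y
    rw [hσ, show τ (σ i) = i from σ.symm_apply_apply i, show τ (σ j) = j from σ.symm_apply_apply j]
    exact ⟨fun h => ⟨⟨h⟩⟩, fun ⟨⟨h⟩⟩ => h⟩

theorem IsRadSqZeroNakayama.of_algEquiv {K Λ Λ' : Type*} [Field K] [Ring Λ] [Algebra K Λ]
    [Ring Λ'] [Algebra K Λ'] (e : Λ ≃ₐ[K] Λ') (h : IsRadSqZeroNakayama K Λ') :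
    IsRadSqZeroNakayama K Λ :=
  h.imp (fun ⟨n, hn, he⟩ => ⟨n, hn, he.map e.trans⟩) fun ⟨n, he⟩ => ⟨n, he.map e.trans⟩

theorem mainTheorem2_general {K : Type u} [Field K] {Λ : Type w} [Ring Λ] [Algebra K Λ]
    [Module.Finite K Λ] [IsNoetherianRing Λᵐᵒᵖ] (hconn : IsConnectedRing Λ)
    (hsplit : InjProjExtensionsSplit (FGModuleCat.{w} Λᵐᵒᵖ))
    {Q : Type uQ} [Quiver.{vQ} Q] [Fintype Q] {I : TwoSidedIdeal (PathAlgebra K Q)}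
    (hI : IsQuadraticMonomial I)
    (right_zero : ∀ {x y : Q} (α : x ⟶ y),
      {β : Quiver.Star y | arrowMul K α β.2 ∈ I}.Subsingleton)
    (left_zero : ∀ {x y : Q} (α : x ⟶ y),
      {γ : Quiver.Costar x | arrowMul K γ.2 α ∈ I}.Subsingleton)
    (e : Λ ≃ₐ[K] I.ringCon.Quotient) : IsRadSqZeroNakayama K Λ := by
  have := hconn.1
  obtain ⟨φ, hφ, rfl⟩ := exists_surjective_algHom_ker_eq e
  have hpot := hsplit.hasVertexPotentials hφ hI
  have ker_le := hI.le_arrowIdealPow_two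
  have ker_eq := ker_le.antisymm (hpot.arrowIdealPow_two_le right_zero)
  have := nonempty_of_algHom φ
  rw [ker_eq] at e
  exact .of_algEquiv e <| isRadSqZeroNakayama_radSqZeroPathAlgebra
    (hpot.subsingleton_star right_zero) (hpot.subsingleton_costar left_zero)
    fun s => hconn.eq_empty_or_eq_univ hφ ker_le

end

theorem mainTheorem2 {K : Type u} [Field K] [IsAlgClosed K] {Λ : Type w} [Ring Λ] [Algebra K Λ]
    [Module.Finite K Λ] (hconn : IsConnectedRing Λ)
    (hgentle : IsGentleAlgebra.{u, w, uQ, vQ} K Λ)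
    (hct : ∃ d : ℕ, 2 ≤ d ∧ HasDClusterTiltingSubcategory K Λ d) :
    IsRadSqZeroNakayama K Λ := by
  obtain ⟨Q, _, _, I, hI, ⟨e⟩⟩ := hgentle
  obtain ⟨d, hd, hU⟩ := hct
  have := isNoetherianRing_mulOpposite K Λ
  exact mainTheorem2_general hconn (hU.injProjExtensionsSplit hd) hI.generated hI.right_zero
    hI.left_zero e
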